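/- Let $a>-1/2$ be real, and let $n,N$ be integers with $1\le n\le N-1$. For real $\alpha>-1$ and $-1<\beta<2a+1$, the Racah polynomial $R_n^{(\alpha,\beta)}$ (with $a$ and $N$ fixed) is the polynomial in $X=x(s)=s(s+1)$ given by $$R_n^{(\alpha,\beta)}(x(s))={}_4F_3\left(\begin{matrix}-n,\ \alpha+\beta+n+1,\ a-s,\ s+a+1\\ 2a+\alpha+N+1,\ \beta+1,\ 1-N\end{matrix}\,;1\right)=\sum_{k=0}^{n}\frac{(-n)_k(\alpha+\beta+n+1)_k(a-s)_k(s+a+1)_k}{(2a+\alpha+N+1)_k(\beta+1)_k(1-N)_k\,k!},$$ where $(u)_k=u(u+1)\cdots(u+k-1)$. Put $J=(-1,2a+1)$ if $a\ge 0$, and $J=(a,2a+1)$ if $-1/2<a<0$. Then for all $\alpha>-1$ and $\beta\in J$ the polynomial $R_n^{(\alpha,\beta)}$ has degree $n$ and its zeros are real, distinct and lie in the interval $\big(x(a),x(a+N-1)\big)$. If they are listed as $Y_1(\alpha,\beta)<\cdots<Y_n(\alpha,\beta)$, then for every $i\in\{1,\dots,n\}$: 1. for each fixed $\beta\in J$,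 $\alpha\mapsto Y_i(\alpha,\beta)$ is strictly decreasing on $(-1,\infty)$; 2. for each fixed $\alpha>-1$, $\beta\mapsto Y_i(\alpha,\beta)$ is strictly increasing on $J$. -/

import Mathlib

/-- The Pochhammer symbol `(x)_k = x (x + 1) ⋯ (x + k - 1)`, with `(x)_0 = 1`. -/
noncomputable def poch (x : ℝ) (k : ℕ) : ℝ := ∏ j ∈ Finset.range k, (x + j)

/-- The generalized hypergeometric series with upper parameters `us`, lower parameters `ls`
and argument `z`. -/
noncomputable def pFq (us ls : List ℝ) (z : ℝ) : ℝ :=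
  ∑' k : ℕ, (us.map (fun u => poch u k)).prod / (ls.map (fun l => poch l k)).prod
    * z ^ k / (k.factorial : ℝ)

/-- The Racah polynomial `R_n^{(α,β)}` of the variable `X = s (s + 1)` on the grid
`s = a, a + 1, …, a + N - 1`. It is the terminating series
`₄F₃(-n, α+β+n+1, a-s, s+a+1; 2a+α+N+1, β+1, 1-N; 1)`, where the product
`(a - s)_k (s + a + 1)_k` is written as the polynomial `∏_{j<k} ((a+j)(a+j+1) - X)` in `X`;
see `racah_eval`. -/
noncomputable def racah (a : ℝ) (N n : ℕ) (α β : ℝ) : Polynomial ℝ :=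
  ∑ k ∈ Finset.range (n + 1),
    Polynomial.C
      (poch (-(n : ℝ)) k * poch (α + β + n + 1) k /
        (poch (2 * a + α + N + 1) k * poch (β + 1) k * poch (1 - (N : ℝ)) k
          * (k.factorial : ℝ))) *
      ∏ j ∈ Finset.range k, (Polynomial.C ((a + j) * (a + j + 1)) - Polynomial.X)

theorem poch_neg_eq_zero {n k : ℕ} (h : n < k) : poch (-(n : ℝ)) k = 0 :=
  Finset.prod_eq_zero (Finset.mem_range.mpr h) (by simp)

/-- The polynomial `racah` evaluated at `X = s (s + 1)` is the hypergeometric series that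
defines the Racah polynomials. -/
theorem racah_eval (a : ℝ) (N n : ℕ) (α β s : ℝ) :
    (racah a N n α β).eval (s * (s + 1)) =
      pFq [-(n : ℝ), α + β + n + 1, a - s, s + a + 1]
        [2 * a + α + N + 1, β + 1, 1 - (N : ℝ)] 1 := by
  unfold pFq
  rw [tsum_eq_sum (s := Finset.range (n + 1))]
  · unfold racah
    rw [Polynomial.eval_finsetSum]
    refine Finset.sum_congr rfl fun k _ => ?_
    have h : ∏ j ∈ Finset.range k, ((a + j) * (a + j + 1) - s * (s + 1)) =
        poch (a - s) k * poch (s + a + 1) k := by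
      unfold poch
      rw [← Finset.prod_mul_distrib]
      exact Finset.prod_congr rfl fun j _ => by ring
    rw [Polynomial.eval_mul, Polynomial.eval_C, Polynomial.eval_prod]
    simp only [Polynomial.eval_sub, Polynomial.eval_C, Polynomial.eval_X]
    rw [h]
    simp only [List.map_cons, List.map_nil, List.prod_cons, List.prod_nil, one_pow, mul_one]
    simp only [div_eq_mul_inv, mul_inv]
    ring
  · intro k hk
    have hk' : n < k := by
      have h := mt Finset.mem_range.mpr hk
      omega
    simp [poch_neg_eq_zero hk']

/-- `y 0 < y 1 < ⋯ < y (n - 1)` are all the zeros of the polynomial `P`, which has exact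
degree `n`. -/
def EnumeratesZeros (P : Polynomial ℝ) {n : ℕ} (y : Fin n → ℝ) : Prop :=
  P.degree = n ∧ StrictMono y ∧ ∀ x : ℝ, P.IsRoot x ↔ ∃ i, y i = x

/-- The Racah polynomials `R_n^{(α,β)}` with `-1 < α` and `β ∈ J` have `n` real and distinct
zeros, located strictly between `x(a)` and `x(a + N - 1)` where `x(s) = s (s + 1)`; listed in
increasing order, each zero is a strictly decreasing function of `α` on `(-1, ∞)` for every
`β ∈ J` and a strictly increasing function of `β` on `J` for every `α > -1`. -/
def RacahZerosMonotone (a : ℝ) (N n : ℕ) (J : Set ℝ) : Prop :=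
  ∃ Y : Fin n → ℝ → ℝ → ℝ,
    (∀ α ∈ Set.Ioi (-1 : ℝ), ∀ β ∈ J,
      EnumeratesZeros (racah a N n α β) (fun i => Y i α β) ∧
      ∀ i, Y i α β ∈ Set.Ioo (a * (a + 1)) ((a + N - 1) * (a + N))) ∧
    (∀ β ∈ J, ∀ i, StrictAntiOn (fun α => Y i α β) (Set.Ioi (-1))) ∧
    (∀ α ∈ Set.Ioi (-1 : ℝ), ∀ i, StrictMonoOn (fun β => Y i α β) J)

/-! The polynomials are orthogonal for a positive weight on the `N` grid points, so their zeros are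
simple and lie strictly inside the grid. Monotonicity is a discrete Markov theorem,
`GridOrthogonal.zeros_lt`, which compares two weights directly instead of differentiating in a
parameter: if `v / w` increases along the grid, every zero for `v` lies to the right of the
corresponding zero for `w`. It is obtained by integrating `(X - t) q²` against both weights, with
`q` chosen so that Gauss quadrature (`GridOrthogonal.exists_gauss_quadrature`) reveals the signs.

Orthogonality needs no summation formula. The weight is defined by detailed balance, which makes a
second-order difference operator symmetric. This operator is bidiagonal in `racahBasis`
(`racahOperator_basis_succ`), and the coefficients of the Racah polynomial are exactly those of an
eigenfunction (`racahOperator_racah`). Symmetry and distinct eigenvalues then kill the moments one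
after another (`gridOrthogonal_racah`).

Since the weight is a product of quotients forward/backward, monotonicity of `v / w` reduces to that
of a single quotient in `α` or `β`, which is elementary. Of `J` only the inclusion in `(-1, 2a + 1)`
matters. -/

/-! ### Zeros of polynomials orthogonal on a finite grid -/

open Polynomial in
/-- A nonzero real polynomial is multiplied by finitely many linear factors vanishing at its own
zeros in `(c, d)` to obtain a polynomial of constant sign on `[c, d]`. -/
theorem exists_roots_mul_prod_constant_sign {c d : ℝ} (m : ℕ) :
    ∀ P : ℝ[X], P ≠ 0 → P.natDegree = m →
      ∃ (Z : Finset ℝ) (ε : ℝ), ε ≠ 0 ∧ (∀ z ∈ Z, P.IsRoot z ∧ z ∈ Set.Ioo c d) ∧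
        ∀ x ∈ Set.Icc c d, 0 ≤ ε * (P * ∏ z ∈ Z, (X - C z)).eval x := by
  induction m with
  | zero =>
    intro P hP hdeg
    rw [eq_C_of_natDegree_eq_zero hdeg] at hP ⊢
    have h0 : P.coeff 0 ≠ 0 := fun h => hP (by rw [h, C_0])
    exact ⟨∅, P.coeff 0, h0, by simp, fun x _ => by simpa using mul_self_nonneg (P.coeff 0)⟩
  | succ m ih =>
    intro P hP hdeg
    by_cases hroot : ∃ z ∈ Set.Ioo c d, P.IsRoot z
    · obtain ⟨z, hz, hPz⟩ := hroot
      obtain ⟨Q, rfl⟩ := dvd_iff_isRoot.mpr hPz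
      have hQ : Q ≠ 0 := right_ne_zero_of_mul hP
      have hQdeg : Q.natDegree = m := by
        rw [natDegree_mul (X_sub_C_ne_zero z) hQ, natDegree_X_sub_C] at hdeg
        omega
      obtain ⟨Z, ε, hε, hZ, hpos⟩ := ih Q hQ hQdeg
      have hroots : ∀ y ∈ Z, ((X - C z) * Q).IsRoot y ∧ y ∈ Set.Ioo c d := fun y hy =>
        ⟨root_mul_left_of_isRoot _ (hZ y hy).1, (hZ y hy).2⟩
      -- Membership of `z` is toggled each time a factor `X - z` is split off, so `Z` collects the
      -- zeros of odd multiplicity. Erasing `z` leaves the product unchanged; inserting it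
      -- contributes `(x - z)²`.
      by_cases hzZ : z ∈ Z
      · refine ⟨Z.erase z, ε, hε, fun y hy => hroots y (Finset.mem_of_mem_erase hy), ?_⟩
        intro x hx
        have h := hpos x hx
        rw [← Finset.mul_prod_erase Z _ hzZ] at h
        convert h using 3
        ring
      · refine ⟨insert z Z, ε, hε, ?_, ?_⟩
        · intro y hy
          rcases Finset.mem_insert.mp hy with rfl | hy
          · exact ⟨hPz, hz⟩
          · exact hroots y hy
        · intro x hx
          have h := mul_nonneg (hpos x hx) (sq_nonneg (x - z))
          rw [Finset.prod_insert hzZ]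
          simp only [eval_mul, eval_sub, eval_X, eval_C] at h ⊢
          linarith
    · push Not at hroot
      by_cases hcd : c < d
      swap
      · rcases (not_lt.mp hcd).eq_or_lt with rfl | hlt
        · by_cases h0 : P.eval d = 0
          · refine ⟨∅, 1, one_ne_zero, by simp, fun x hx => ?_⟩
            obtain rfl : x = d := le_antisymm hx.2 hx.1
            simp [h0]
          · refine ⟨∅, P.eval d, h0, by simp, fun x hx => ?_⟩
            obtain rfl : x = d := le_antisymm hx.2 hx.1
            simpa using mul_self_nonneg (P.eval x)
        · exact ⟨∅, 1, one_ne_zero, by simp, fun x hx =>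
            absurd (hx.1.trans hx.2) (not_le.mpr hlt)⟩
      · obtain ⟨e, he⟩ := exists_between hcd
        -- The sign is constant on the open interval by the intermediate value theorem; closure
        -- extends the weak inequality to the endpoints, where `P` may vanish.
        have hopen : ∀ x ∈ Set.Ioo c d, 0 < P.eval e * P.eval x := by
          intro x hx
          by_contra hle
          have hcont : ContinuousOn (fun t => P.eval e * P.eval t) (Set.uIcc e x) :=
            (continuous_const.mul P.continuous).continuousOn
          have hmem : (0 : ℝ) ∈ Set.uIcc (P.eval e * P.eval e) (P.eval e * P.eval x) :=
            Set.mem_uIcc.mpr (Or.inr ⟨not_lt.mp hle, mul_self_nonneg _⟩)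
          obtain ⟨t, ht, ht0⟩ := intermediate_value_uIcc hcont hmem
          have htI : t ∈ Set.Ioo c d := Set.OrdConnected.uIcc_subset Set.ordConnected_Ioo he hx ht
          rcases mul_eq_zero.mp ht0 with h | h
          · exact hroot e he h
          · exact hroot t htI h
        refine ⟨∅, P.eval e, hroot e he, by simp, fun x hx => ?_⟩
        have hclosed : IsClosed {t : ℝ | 0 ≤ P.eval e * P.eval t} :=
          isClosed_le continuous_const (continuous_const.mul P.continuous)
        have hsub : closure (Set.Ioo c d) ⊆ {t : ℝ | 0 ≤ P.eval e * P.eval t} :=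
          hclosed.closure_subset_iff.mpr fun t ht => (hopen t ht).le
        rw [closure_Ioo hcd.ne] at hsub
        simpa using hsub hx

open Polynomial in
/-- A polynomial with at least as many zeros as a finite grid that exceeds its degree is zero. -/
theorem exists_grid_eval_ne_zero {x : ℕ → ℝ} (hx : StrictMono x) {P : ℝ[X]} (hP : P ≠ 0)
    (s : Finset ℕ) (hs : P.natDegree < s.card) : ∃ k ∈ s, P.eval (x k) ≠ 0 := by
  by_contra! h
  refine hP (eq_zero_of_natDegree_lt_card_of_eval_eq_zero' P (s.image x) ?_ ?_)
  · simpa using h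
  · rwa [Finset.card_image_of_injective _ hx.injective]

/-- `P` is orthogonal to all polynomials of degree less than `n`, for the discrete measure with
masses `w k` at the points `x k`, `k < N`. -/
def GridOrthogonal (N n : ℕ) (x w : ℕ → ℝ) (P : Polynomial ℝ) : Prop :=
  ∀ q : Polynomial ℝ, q.degree < n → ∑ k ∈ Finset.range N, w k * (P * q).eval (x k) = 0

open Polynomial in
/-- The zeros of a discrete orthogonal polynomial are real, simple and inside the grid. -/
theorem GridOrthogonal.exists_enumeratesZeros {N n : ℕ} (hnN : n < N) {x w : ℕ → ℝ}
    (hx : StrictMono x) (hw : ∀ k < N, 0 < w k) {P : ℝ[X]} (hP : P.degree = n)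
    (horth : GridOrthogonal N n x w P) :
    ∃ y : Fin n → ℝ, EnumeratesZeros P y ∧ ∀ i, y i ∈ Set.Ioo (x 0) (x (N - 1)) := by
  have hP0 : P ≠ 0 := by
    rintro rfl
    simp at hP
  have hnat : P.natDegree = n := natDegree_eq_of_degree_eq_some hP
  obtain ⟨Z, ε, hε, hZ, hpos⟩ :=
    exists_roots_mul_prod_constant_sign (c := x 0) (d := x (N - 1)) n P hP0 hnat
  have hsub : Z ⊆ P.roots.toFinset := fun z hz => by simpa [hP0] using (hZ z hz).1
  have hle : P.roots.toFinset.card ≤ n :=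
    (Multiset.toFinset_card_le _).trans ((card_roots' P).trans hnat.le)
  have hcard : n ≤ Z.card := by
    -- With fewer than `n` factors the product over `Z` is an admissible test polynomial, so a sum
    -- of nonnegative terms vanishes.
    by_contra! hlt
    have hdeg : (∏ z ∈ Z, (X - C z)).degree < (n : WithBot ℕ) := by
      rw [degree_prod]
      simpa using hlt
    have hsum := horth _ hdeg
    have hnn : ∀ k ∈ Finset.range N,
        0 ≤ w k * (ε * (P * ∏ z ∈ Z, (X - C z)).eval (x k)) := by
      intro k hk
      have hk := Finset.mem_range.mp hk
      exact mul_nonneg (hw k hk).le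
        (hpos _ ⟨hx.monotone (Nat.zero_le k), hx.monotone (by omega)⟩)
    have hzero : ∑ k ∈ Finset.range N,
        w k * (ε * (P * ∏ z ∈ Z, (X - C z)).eval (x k)) = 0 := by
      rw [← mul_zero ε, ← hsum, Finset.mul_sum]
      exact Finset.sum_congr rfl fun k _ => by ring
    -- At a grid point where `P` is nonzero the product over `Z` must vanish, yet every element of
    -- `Z` is a zero of `P`.
    obtain ⟨k, hk, hne⟩ := exists_grid_eval_ne_zero hx hP0 (Finset.range N)
      (by simpa [hnat] using hnN)
    have h := (Finset.sum_eq_zero_iff_of_nonneg hnn).mp hzero k hk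
    have hwk := (hw k (Finset.mem_range.mp hk)).ne'
    simp only [mul_eq_zero, hwk, hε, eval_mul, hne, false_or, eval_prod,
      Finset.prod_eq_zero_iff, eval_sub, eval_X, eval_C, sub_eq_zero] at h
    obtain ⟨z, hz, hxz⟩ := h
    exact hne (hxz ▸ (hZ z hz).1)
  have hZeq : Z = P.roots.toFinset := Finset.eq_of_subset_of_card_le hsub (hle.trans hcard)
  have hZcard : Z.card = n := le_antisymm (hZeq ▸ hle) hcard
  refine ⟨Z.orderEmbOfFin hZcard, ⟨hP, (Z.orderEmbOfFin hZcard).strictMono, fun t => ?_⟩,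
    fun i => (hZ _ (Z.orderEmbOfFin_mem hZcard i)).2⟩
  have h1 : t ∈ Set.range (Z.orderEmbOfFin hZcard) ↔ t ∈ Z := by simp
  rw [← Set.mem_range, h1, hZeq]
  simp [hP0]

open Polynomial in
/-- Gauss quadrature at the zeros of a discrete orthogonal polynomial. -/
theorem GridOrthogonal.exists_gauss_quadrature {N n : ℕ} {x w : ℕ → ℝ}
    (hw : ∀ k < N, 0 < w k) {P : ℝ[X]} {y : Fin n → ℝ} (hy : EnumeratesZeros P y)
    (horth : GridOrthogonal N n x w P) :
    ∃ l : Fin n → ℝ, (∀ j, 0 ≤ l j) ∧ ∀ f : ℝ[X], f.degree < (2 * n : ℕ) →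
      ∑ k ∈ Finset.range N, w k * f.eval (x k) = ∑ j, l j * f.eval (y j) := by
  obtain ⟨hP, hmono, hroot⟩ := hy
  have hP0 : P ≠ 0 := by
    rintro rfl
    simp at hP
  -- Such an `f` is `P` times a quotient of degree less than `n`, to which orthogonality applies.
  have hvanish : ∀ f : ℝ[X], f.degree < (2 * n : ℕ) → (∀ j, f.eval (y j) = 0) →
      ∑ k ∈ Finset.range N, w k * f.eval (x k) = 0 := by
    intro f hf hfy
    have hmod : f % P = 0 := by
      refine eq_zero_of_degree_lt_of_eval_index_eq_zero (v := y) Finset.univ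
        hmono.injective.injOn ?_ fun j _ => ?_
      · simpa [hP] using degree_mod_lt f hP0
      · have hPj : P.eval (y j) = 0 := (hroot _).mpr ⟨j, rfl⟩
        have h := congrArg (eval (y j)) (EuclideanDomain.div_add_mod f P)
        simpa [hPj, hfy j] using h
    have hfac : P * (f / P) = f := by
      simpa [hmod] using EuclideanDomain.div_add_mod f P
    rw [← hfac]
    refine horth _ ?_
    rw [← hfac, degree_mul, hP] at hf
    by_cases h0 : f / P = 0
    · simp [h0]
    · rw [degree_eq_natDegree h0] at hf ⊢
      norm_cast at hf ⊢
      omega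
  -- The quadrature weights are integrals of squared Lagrange polynomials: they are visibly
  -- nonnegative, and the squares still interpolate at the nodes with degree `2n - 2`.
  refine ⟨fun j => ∑ k ∈ Finset.range N,
    w k * ((Lagrange.basis Finset.univ y j) ^ 2).eval (x k), fun j => ?_, fun f hf => ?_⟩
  · refine Finset.sum_nonneg fun k hk => mul_nonneg (hw k (Finset.mem_range.mp hk)).le ?_
    rw [eval_pow]
    exact sq_nonneg _
  · have h := hvanish (f - ∑ j, C (f.eval (y j)) * (Lagrange.basis Finset.univ y j) ^ 2) ?_ ?_
    · simp only [eval_sub, eval_finsetSum, eval_mul, eval_C, mul_sub, Finset.sum_sub_distrib,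
        sub_eq_zero, Finset.mul_sum] at h
      rw [h, Finset.sum_comm]
      simp only [Finset.sum_mul]
      exact Finset.sum_congr rfl fun j _ => Finset.sum_congr rfl fun k _ => by ring
    · refine (degree_sub_le _ _).trans_lt (max_lt hf ?_)
      refine (degree_sum_le _ _).trans_lt ((Finset.sup_lt_iff (WithBot.bot_lt_coe _)).mpr ?_)
      intro j _
      refine (degree_mul_le _ _).trans_lt
        (lt_of_le_of_lt (add_le_add_left degree_C_le _) ?_)
      rw [zero_add, degree_pow, Lagrange.degree_basis hmono.injective.injOn (Finset.mem_univ j)]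
      have := j.pos
      simp only [Finset.card_univ, Fintype.card_fin, nsmul_eq_mul]
      norm_cast
      omega
    · intro j
      simp only [eval_sub, eval_finsetSum, eval_mul, eval_C, eval_pow]
      rw [Finset.sum_eq_single j]
      · rw [Lagrange.eval_basis_self hmono.injective.injOn (Finset.mem_univ j)]
        ring
      · intro i _ hij
        rw [Lagrange.eval_basis_of_ne hij (Finset.mem_univ j)]
        ring
      · simp

open Polynomial in
/-- Tilting a discrete measure by a strictly increasing density moves the zeros of the orthogonal
polynomial to the right. -/
theorem GridOrthogonal.zeros_lt {N n : ℕ} (hnN : n < N) {x w v : ℕ → ℝ} (hx : StrictMono x)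
    (hw : ∀ k < N, 0 < w k) (hv : ∀ k < N, 0 < v k)
    (hratio : ∀ j k, j < k → k < N → v j / w j < v k / w k)
    {P Q : ℝ[X]} {y z : Fin n → ℝ} (hy : EnumeratesZeros P y) (hz : EnumeratesZeros Q z)
    (hP : GridOrthogonal N n x w P) (hQ : GridOrthogonal N n x v Q) (i : Fin n)
    (hyi : y i < x (N - 1)) : y i < z i := by
  classical
  set A : Finset (Fin n) := Finset.Iio i
  set B : Finset (Fin n) := Finset.Ioi i
  -- `q` has degree `n - 1`, so `(X - t) q²` has degree `2n - 1` and both quadratures are exact. At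
  -- the nodes `y j` only `j ≥ i` survive, where `X - y i` is nonnegative; at the nodes `z j` only
  -- `j ≤ i`, where `X - z i` is nonpositive.
  set q : ℝ[X] := (∏ j ∈ A, (X - C (y j))) * ∏ j ∈ B, (X - C (z j)) with hq
  have hq0 : q ≠ 0 := mul_ne_zero (Finset.prod_ne_zero_iff.mpr fun j _ => X_sub_C_ne_zero _)
    (Finset.prod_ne_zero_iff.mpr fun j _ => X_sub_C_ne_zero _)
  have hcardA : A.card = i := by simp [A]
  have hcardB : B.card = n - 1 - i := by
    simp [B]
  have hqdeg : q.natDegree = n - 1 := by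
    rw [hq, natDegree_mul (left_ne_zero_of_mul hq0) (right_ne_zero_of_mul hq0),
      natDegree_finsetProd_X_sub_C_eq_card, natDegree_finsetProd_X_sub_C_eq_card, hcardA, hcardB]
    have := i.isLt
    omega
  have hdeg : ∀ t : ℝ, ((X - C t) * q ^ 2).degree < ((2 * n : ℕ) : WithBot ℕ) := by
    intro t
    rw [degree_mul, degree_X_sub_C, degree_pow, degree_eq_natDegree hq0, hqdeg, nsmul_eq_mul]
    have := i.isLt
    norm_cast
    omega
  have hlow : 0 ≤ ∑ k ∈ Finset.range N, w k * ((X - C (y i)) * q ^ 2).eval (x k) := by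
    obtain ⟨l, hl, hgauss⟩ := hP.exists_gauss_quadrature hw hy
    rw [hgauss _ (hdeg _)]
    refine Finset.sum_nonneg fun j _ => mul_nonneg (hl j) ?_
    simp only [eval_mul, eval_sub, eval_X, eval_C, eval_pow]
    rcases lt_or_ge j i with hji | hji
    · have : q.eval (y j) = 0 := by
        rw [hq, eval_mul, eval_prod, Finset.prod_eq_zero (i := j) (by simpa [A] using hji)
          (by simp), zero_mul]
      simp [this]
    · exact mul_nonneg (sub_nonneg.mpr (hy.2.1.monotone hji)) (sq_nonneg _)
  have hhigh : ∑ k ∈ Finset.range N, v k * ((X - C (z i)) * q ^ 2).eval (x k) ≤ 0 := by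
    obtain ⟨l, hl, hgauss⟩ := hQ.exists_gauss_quadrature hv hz
    rw [hgauss _ (hdeg _)]
    refine Finset.sum_nonpos fun j _ => mul_nonpos_of_nonneg_of_nonpos (hl j) ?_
    simp only [eval_mul, eval_sub, eval_X, eval_C, eval_pow]
    rcases lt_or_ge i j with hij | hij
    · have : q.eval (z j) = 0 := by
        rw [hq, eval_mul, eval_prod, eval_prod,
          Finset.prod_eq_zero (s := B) (i := j) (by simpa [B] using hij) (by simp), mul_zero]
      simp [this]
    · exact mul_nonpos_of_nonpos_of_nonneg (sub_nonpos.mpr (hz.2.1.monotone hij)) (sq_nonneg _)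
  simp only [eval_mul, eval_sub, eval_X, eval_C, eval_pow] at hlow hhigh
  have hex : ∃ k, y i ≤ x k := ⟨N - 1, hyi.le⟩
  -- `m` is the first grid index with `x m ≥ y i`. Both `v k / w k - v m / w m` and `x k - y i`
  -- change sign there, so their product is never negative.
  set m := Nat.find hex
  have hm : y i ≤ x m := Nat.find_spec hex
  have hmN : m < N := lt_of_le_of_lt (Nat.find_min' hex hyi.le) (by omega)
  have hbelow : ∀ k < m, x k < y i := fun k hk => not_le.mp (Nat.find_min hex hk)
  have hterm : ∀ k ∈ Finset.range N,
      v m / w m * (w k * ((x k - y i) * q.eval (x k) ^ 2)) ≤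
        v k * ((x k - y i) * q.eval (x k) ^ 2) := by
    intro k hk
    have hk := Finset.mem_range.mp hk
    have hvk : v k = v k / w k * w k := (div_mul_cancel₀ _ (hw k hk).ne').symm
    rw [hvk, mul_assoc]
    rcases lt_trichotomy k m with h | h | h
    · refine mul_le_mul_of_nonpos_right (hratio k m h hmN).le
        (mul_nonpos_of_nonneg_of_nonpos (hw k hk).le
        (mul_nonpos_of_nonpos_of_nonneg (sub_nonpos.mpr (hbelow k h).le) (sq_nonneg _)))
    · rw [h]
    · refine mul_le_mul_of_nonneg_right (hratio m k h hk).le (mul_nonneg (hw k hk).le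
        (mul_nonneg (sub_nonneg.mpr (hm.trans (hx h).le)) (sq_nonneg _)))
  -- The index `m` gives equality and is left out; the other `N - 1 > deg q` grid points include one
  -- where `q` is nonzero and the inequality strict.
  have hcard : q.natDegree < ((Finset.range N).erase m).card := by
    rw [Finset.card_erase_of_mem (Finset.mem_range.mpr hmN), Finset.card_range, hqdeg]
    have := i.isLt
    omega
  obtain ⟨k, hkmem, hqk⟩ := exists_grid_eval_ne_zero hx hq0 _ hcard
  obtain ⟨hkm, hkN⟩ := Finset.mem_erase.mp hkmem
  have hqpos : 0 < q.eval (x k) ^ 2 := by positivity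
  have hk := Finset.mem_range.mp hkN
  have hstrict : v m / w m * (w k * ((x k - y i) * q.eval (x k) ^ 2)) <
        v k * ((x k - y i) * q.eval (x k) ^ 2) := by
    have hvk : v k = v k / w k * w k := (div_mul_cancel₀ _ (hw k hk).ne').symm
    rw [hvk, mul_assoc]
    rcases lt_or_gt_of_ne hkm with h | h
    · exact mul_lt_mul_of_neg_right (hratio k m h hmN) (mul_neg_of_pos_of_neg (hw k hk)
        (mul_neg_of_neg_of_pos (sub_neg.mpr (hbelow k h)) hqpos))
    · exact mul_lt_mul_of_pos_right (hratio m k h hk) (mul_pos (hw k hk)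
        (mul_pos (sub_pos.mpr (hm.trans_lt (hx h))) hqpos))
  have hpos : 0 < ∑ k ∈ Finset.range N, v k * ((x k - y i) * q.eval (x k) ^ 2) := by
    refine lt_of_le_of_lt ?_ (Finset.sum_lt_sum hterm ⟨k, hkN, hstrict⟩)
    rw [← Finset.mul_sum]
    exact mul_nonneg (div_pos (hv m hmN) (hw m hmN)).le hlow
  -- If `z i ≤ y i`, replacing `y i` by `z i` could only increase the positive sum, against `hhigh`.
  by_contra! hle
  refine absurd (hpos.trans_le (Finset.sum_le_sum fun k hk => ?_)) (not_lt.mpr hhigh)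
  exact mul_le_mul_of_nonneg_left
    (mul_le_mul_of_nonneg_right (by linarith) (sq_nonneg _))
    (hv k (Finset.mem_range.mp hk)).le

/-! ### The Racah difference operator and its symmetry -/

/-- The coefficient of the forward difference in the Racah difference operator. -/
noncomputable def racahForward (a : ℝ) (N : ℕ) (α β : ℝ) (j : ℕ) : ℝ :=
  (j + β + 1) * (j + 2 * a + α + N + 1) * (N - 1 - j) * (j + 2 * a + 1) /
    ((2 * j + 2 * a + 1) * (2 * j + 2 * a + 2))

/-- The coefficient of the backward difference in the Racah difference operator. -/
noncomputable def racahBackward (a : ℝ) (N : ℕ) (α β : ℝ) (j : ℕ) : ℝ :=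
  j * (j + 2 * a - β) * (N + α - j) * (j + 2 * a + N) /
    ((2 * j + 2 * a) * (2 * j + 2 * a + 1))

/-- The weight that makes the Racah difference operator self-adjoint. -/
noncomputable def racahWeight (a : ℝ) (N : ℕ) (α β : ℝ) (k : ℕ) : ℝ :=
  ∏ j ∈ Finset.range k, racahForward a N α β j / racahBackward a N α β (j + 1)

/-- The Racah difference operator on functions on the grid. -/
noncomputable def racahOperator (a : ℝ) (N : ℕ) (α β : ℝ) (f : ℕ → ℝ) (j : ℕ) : ℝ :=
  racahForward a N α β j * (f (j + 1) - f j) + racahBackward a N α β j * (f (j - 1) - f j)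

/-- The quadratic lattice `x(a + k)` with `x(s) = s (s + 1)`. -/
def racahGrid (a : ℝ) (k : ℕ) : ℝ := (a + k) * (a + k + 1)

open Polynomial in
/-- The polynomial `∏_{j<k} (x(a + j) - X)`. -/
noncomputable def racahBasis (a : ℝ) (k : ℕ) : ℝ[X] :=
  ∏ j ∈ Finset.range k, (C ((a + j) * (a + j + 1)) - X)

section

variable {a : ℝ} {N : ℕ} {α β : ℝ}

theorem racahGrid_strictMono (ha : -1 / 2 < a) : StrictMono (racahGrid a) := by
  refine strictMono_nat_of_lt_succ fun k => ?_
  have hk : (0 : ℝ) ≤ k := k.cast_nonneg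
  unfold racahGrid
  push_cast
  nlinarith

theorem racahForward_pos (ha : -1 / 2 < a) (hα : -1 < α) (hβ : -1 < β) {j : ℕ}
    (hj : j + 1 < N) : 0 < racahForward a N α β j := by
  have hj0 : (0 : ℝ) ≤ j := j.cast_nonneg
  have hjN : (j : ℝ) + 1 < N := by exact_mod_cast hj
  unfold racahForward
  have h1 : 0 < j + β + 1 := by linarith
  have h2 : 0 < j + 2 * a + α + N + 1 := by linarith
  have h3 : (0 : ℝ) < N - 1 - j := by linarith
  have h4 : 0 < j + 2 * a + 1 := by linarith
  have h5 : 0 < 2 * j + 2 * a + 1 := by linarith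
  have h6 : 0 < 2 * j + 2 * a + 2 := by linarith
  positivity

theorem racahBackward_succ_pos (ha : -1 / 2 < a) (hα : -1 < α) (hβ : β < 2 * a + 1) {j : ℕ}
    (hj : j + 1 < N) : 0 < racahBackward a N α β (j + 1) := by
  have hj0 : (0 : ℝ) ≤ j := j.cast_nonneg
  have hjN : (j : ℝ) + 1 + 1 ≤ N := by exact_mod_cast hj
  unfold racahBackward
  push_cast
  have h1 : 0 < j + 1 + 2 * a - β := by linarith
  have h2 : 0 < N + α - (j + 1) := by linarith
  have h3 : 0 < j + 1 + 2 * a + N := by linarith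
  have h4 : 0 < 2 * ((j : ℝ) + 1) + 2 * a := by linarith
  have h5 : 0 < 2 * ((j : ℝ) + 1) + 2 * a + 1 := by linarith
  positivity

theorem racahWeight_pos (ha : -1 / 2 < a) (hα : -1 < α) (hβ : β ∈ Set.Ioo (-1) (2 * a + 1))
    {k : ℕ} (hk : k < N) : 0 < racahWeight a N α β k := by
  refine Finset.prod_pos fun j hj => ?_
  have hj := Finset.mem_range.mp hj
  exact div_pos (racahForward_pos ha hα hβ.1 (by omega))
    (racahBackward_succ_pos ha hα hβ.2 (by omega))

/-- Detailed balance, the source of the symmetry of the operator. -/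
theorem racahWeight_mul_forward (ha : -1 / 2 < a) (hα : -1 < α) (hβ : β < 2 * a + 1) {k : ℕ}
    (hk : k + 1 < N) : racahWeight a N α β (k + 1) * racahBackward a N α β (k + 1) =
      racahWeight a N α β k * racahForward a N α β k := by
  have h := (racahBackward_succ_pos (N := N) ha hα hβ hk).ne'
  unfold racahWeight
  rw [Finset.prod_range_succ]
  field_simp

/-- Summation by parts for the Racah difference operator. -/
theorem sum_racahWeight_mul_operator (ha : -1 / 2 < a) (hα : -1 < α) (hβ : β < 2 * a + 1)
    (f g : ℕ → ℝ) :
    ∑ k ∈ Finset.range N, racahWeight a N α β k * (racahOperator a N α β f k * g k) =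
      -∑ k ∈ Finset.range (N - 1), racahWeight a N α β k * racahForward a N α β k *
        ((f (k + 1) - f k) * (g (k + 1) - g k)) := by
  rcases N with _ | M
  · simp
  -- The boundary terms vanish through the factors `N - 1 - j` at the last grid point and `j` at the
  -- first.
  have hlast : racahForward a (M + 1 : ℕ) α β M = 0 := by simp [racahForward]
  have hfirst : racahBackward a (M + 1 : ℕ) α β 0 = 0 := by simp [racahBackward]
  simp only [racahOperator, add_mul, mul_add, Finset.sum_add_distrib]
  rw [Finset.sum_range_succ, hlast,
    Finset.sum_range_succ' (fun k => racahWeight a (M + 1 : ℕ) α β k *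
      (racahBackward a (M + 1 : ℕ) α β k * (f (k - 1) - f k) * g k)), hfirst]
  simp only [zero_mul, mul_zero, add_zero, Nat.add_sub_cancel]
  rw [← Finset.sum_add_distrib, ← Finset.sum_neg_distrib]
  refine Finset.sum_congr rfl fun k hk => ?_
  have h := racahWeight_mul_forward (N := M + 1) ha hα hβ
    (Nat.succ_lt_succ (Finset.mem_range.mp hk))
  linear_combination (f k - f (k + 1)) * g (k + 1) * h

/-- Summation by parts yields an expression symmetric in `f` and `g`. -/
theorem sum_racahWeight_operator_comm (ha : -1 / 2 < a) (hα : -1 < α) (hβ : β < 2 * a + 1)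
    (f g : ℕ → ℝ) :
    ∑ k ∈ Finset.range N, racahWeight a N α β k * (racahOperator a N α β f k * g k) =
      ∑ k ∈ Finset.range N, racahWeight a N α β k * (f k * racahOperator a N α β g k) := by
  simp only [mul_comm (f _)]
  rw [sum_racahWeight_mul_operator ha hα hβ, sum_racahWeight_mul_operator ha hα hβ]
  simp only [mul_comm (f (_ + 1) - _)]

/-! ### Action of the operator on the basis `racahBasis` -/

theorem racahBasis_eval_grid (k j : ℕ) :
    (racahBasis a k).eval (racahGrid a j) = poch (-(j : ℝ)) k * poch (j + 2 * a + 1) k := by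
  unfold racahBasis poch
  rw [Polynomial.eval_prod, ← Finset.prod_mul_distrib]
  refine Finset.prod_congr rfl fun i _ => ?_
  simp only [racahGrid, Polynomial.eval_sub, Polynomial.eval_C, Polynomial.eval_X]
  ring

theorem poch_succ (x : ℝ) (k : ℕ) : poch x (k + 1) = poch x k * (x + k) :=
  Finset.prod_range_succ _ _

theorem poch_succ' (x : ℝ) (k : ℕ) : poch x (k + 1) = x * poch (x + 1) k := by
  unfold poch
  rw [Finset.prod_range_succ']
  push_cast
  simp only [add_zero, add_assoc, add_comm (1 : ℝ), mul_comm x]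

/-- The factor `2j + 2a + 2` is the grid step `x(a + j + 1) - x(a + j)`, produced by differencing
`racahBasis`; it cancels a denominator here and in `racahBackward_succ_mul`. -/
theorem racahForward_mul (ha : -1 / 2 < a) (j : ℕ) :
    racahForward a N α β j * (2 * j + 2 * a + 2) =
      (j + β + 1) * (j + 2 * a + α + N + 1) * (N - 1 - j) * (j + 2 * a + 1) /
        (2 * j + 2 * a + 1) := by
  have hj0 : (0 : ℝ) ≤ j := j.cast_nonneg
  have hd : 2 * (j : ℝ) + 2 * a + 2 ≠ 0 := by linarith
  rw [racahForward, div_mul_eq_mul_div, mul_div_mul_right _ _ hd]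

theorem racahBackward_succ_mul (ha : -1 / 2 < a) (j : ℕ) :
    racahBackward a N α β (j + 1) * (2 * j + 2 * a + 2) =
      (j + 1) * (j + 1 + 2 * a - β) * (N + α - (j + 1)) * (j + 1 + 2 * a + N) /
        (2 * (j + 1) + 2 * a + 1) := by
  have hj0 : (0 : ℝ) ≤ j := j.cast_nonneg
  have hd : 2 * (j : ℝ) + 2 * a + 2 ≠ 0 := by linarith
  rw [racahBackward]
  push_cast
  rw [show 2 * ((j : ℝ) + 1) + 2 * a = 2 * j + 2 * a + 2 by ring, div_mul_eq_mul_div,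
    mul_comm (2 * (j : ℝ) + 2 * a + 2) (2 * j + 2 * a + 2 + 1), mul_div_mul_right _ _ hd]

theorem racahBasis_succ_forward_diff (k j : ℕ) :
    (racahBasis a (k + 1)).eval (racahGrid a (j + 1)) -
      (racahBasis a (k + 1)).eval (racahGrid a j) =
      -(k + 1) * (2 * j + 2 * a + 2) * (poch (-(j : ℝ)) k * poch (j + 2 * a + 2) k) := by
  have h3 := poch_succ' (-((j : ℝ) + 1)) k
  have h2 := poch_succ' ((j : ℝ) + 2 * a + 1) k
  rw [show -((j : ℝ) + 1) + 1 = -j by ring] at h3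
  rw [show (j : ℝ) + 2 * a + 1 + 1 = j + 2 * a + 2 by ring] at h2
  rw [racahBasis_eval_grid, racahBasis_eval_grid, h2, poch_succ (-(j : ℝ))]
  push_cast
  rw [h3, show (j : ℝ) + 1 + 2 * a + 1 = j + 2 * a + 2 by ring, poch_succ]
  ring

/-- The Racah difference operator is bidiagonal in the basis `racahBasis`. -/
theorem racahOperator_basis_succ (ha : -1 / 2 < a) (k j : ℕ) :
    racahOperator a N α β (fun i => (racahBasis a (k + 1)).eval (racahGrid a i)) j =
      -(k + 1) * (k + α + β + 2) * (racahBasis a (k + 1)).eval (racahGrid a j) -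
        (k + 1) * (2 * a + α + N + 1 + k) * (β + 1 + k) * (N - 1 - k) *
          (racahBasis a k).eval (racahGrid a j) := by
  have hj0 : (0 : ℝ) ≤ j := j.cast_nonneg
  have hd : 2 * (j : ℝ) + 2 * a + 1 ≠ 0 := by linarith
  have hforward : racahForward a N α β j * ((racahBasis a (k + 1)).eval (racahGrid a (j + 1)) -
      (racahBasis a (k + 1)).eval (racahGrid a j)) =
      -(k + 1) * ((j + β + 1) * (j + 2 * a + α + N + 1) * (N - 1 - j) * (j + 2 * a + 1 + k) /
        (2 * j + 2 * a + 1)) * (racahBasis a k).eval (racahGrid a j) := by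
    have h := (poch_succ' ((j : ℝ) + 2 * a + 1) k).symm.trans (poch_succ _ k)
    rw [show (j : ℝ) + 2 * a + 1 + 1 = j + 2 * a + 2 by ring] at h
    rw [racahBasis_succ_forward_diff, racahBasis_eval_grid]
    linear_combination -(k + 1) * (poch (-(j : ℝ)) k * poch (j + 2 * a + 2) k) *
      racahForward_mul (N := N) (α := α) (β := β) ha j -
      (k + 1) * poch (-(j : ℝ)) k * ((j + β + 1) * (j + 2 * a + α + N + 1) * (N - 1 - j) /
        (2 * j + 2 * a + 1)) * h
  have hbackward : racahBackward a N α β j *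
      ((racahBasis a (k + 1)).eval (racahGrid a (j - 1)) -
      (racahBasis a (k + 1)).eval (racahGrid a j)) =
      -(k + 1) * ((k - j) * (j + 2 * a - β) * (N + α - j) * (j + 2 * a + N) /
        (2 * j + 2 * a + 1)) * (racahBasis a k).eval (racahGrid a j) := by
    -- At `j = 0` the left side is zero whatever `j - 1` means. The right side vanishes through `k -
    -- j` when `k = 0`, and through the basis polynomial when `k > 0`.
    rcases j with _ | j
    · rcases k with _ | k
      · simp [racahBackward]
      · have h : poch 0 (k + 1) = 0 := by simp [poch_succ']
        simp [racahBackward, racahBasis_eval_grid, h]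
    · have h := (poch_succ' (-((j : ℝ) + 1)) k).symm.trans (poch_succ _ k)
      rw [show -((j : ℝ) + 1) + 1 = -j by ring] at h
      have hdiff := racahBasis_succ_forward_diff (a := a) k j
      rw [Nat.add_sub_cancel, ← neg_sub, hdiff, racahBasis_eval_grid]
      push_cast
      rw [show (j : ℝ) + 1 + 2 * a + 1 = j + 2 * a + 2 by ring]
      linear_combination (k + 1) * (poch (-(j : ℝ)) k * poch (j + 2 * a + 2) k) *
        racahBackward_succ_mul (N := N) (α := α) (β := β) ha j -
        (k + 1) * poch (j + 2 * a + 2) k * ((j + 1 + 2 * a - β) * (N + α - (j + 1)) *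
          (j + 1 + 2 * a + N) / (2 * (j + 1) + 2 * a + 1)) * h
  have hbasis : (racahBasis a (k + 1)).eval (racahGrid a j) =
      (racahBasis a k).eval (racahGrid a j) * ((k - j) * (j + 2 * a + 1 + k)) := by
    rw [racahBasis_eval_grid, racahBasis_eval_grid, poch_succ, poch_succ]
    ring
  -- The two numerators together are divisible by `2j + 2a + 1`; the quotient splits into the
  -- diagonal and the lowering part.
  have hpoly : (j + β + 1) * (j + 2 * a + α + N + 1) * (N - 1 - j) * (j + 2 * a + 1 + k) +
      (k - j) * (j + 2 * a - β) * (N + α - j) * (j + 2 * a + N) =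
      (2 * (j : ℝ) + 2 * a + 1) * ((k + α + β + 2) * ((k - j) * (j + 2 * a + 1 + k)) +
        (2 * a + α + N + 1 + k) * (β + 1 + k) * (N - 1 - k)) := by
    ring
  have hdiv := congrArg (· / (2 * (j : ℝ) + 2 * a + 1)) hpoly
  simp only [add_div] at hdiv
  rw [mul_div_cancel_left₀ _ hd] at hdiv
  unfold racahOperator
  rw [hforward, hbackward, hbasis]
  linear_combination -(k + 1) * (racahBasis a k).eval (racahGrid a j) * hdiv

theorem racahOperator_basis_zero (j : ℕ) :
    racahOperator a N α β (fun i => (racahBasis a 0).eval (racahGrid a i)) j = 0 := by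
  simp [racahOperator, racahBasis]

/-! ### Degree and eigenvalue equation of the Racah polynomials -/

/-- The coefficient of `racahBasis a k` in the Racah polynomial of degree `n`. -/
noncomputable def racahCoeff (a : ℝ) (N n : ℕ) (α β : ℝ) (k : ℕ) : ℝ :=
  poch (-(n : ℝ)) k * poch (α + β + n + 1) k /
    (poch (2 * a + α + N + 1) k * poch (β + 1) k * poch (1 - (N : ℝ)) k * (k.factorial : ℝ))

theorem racah_eq_sum (n : ℕ) : racah a N n α β =
    ∑ k ∈ Finset.range (n + 1), Polynomial.C (racahCoeff a N n α β k) * racahBasis a k := rfl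

theorem poch_pos {x : ℝ} (hx : 0 < x) (k : ℕ) : 0 < poch x k :=
  Finset.prod_pos fun j _ => by positivity

theorem poch_ne_zero_of_add_lt_one {x : ℝ} {k : ℕ} (hx : x + k < 1) : poch x k ≠ 0 :=
  Finset.prod_ne_zero_iff.mpr fun j hj => by
    have : (j : ℝ) + 1 ≤ k := by exact_mod_cast Finset.mem_range.mp hj
    linarith

/-- The multiplier on the left is the lowering coefficient of the operator, the one on the right a
difference of eigenvalues: this recurrence is the eigenvalue equation in coordinates. -/
theorem racahCoeff_succ (ha : -1 / 2 < a) (hα : -1 < α) (hβ : -1 < β) (n : ℕ) {k : ℕ}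
    (hk : k + 1 < N) : racahCoeff a N n α β (k + 1) *
      ((k + 1) * (2 * a + α + N + 1 + k) * (β + 1 + k) * (N - 1 - k)) =
      racahCoeff a N n α β k * ((n - k) * (n + k + α + β + 1)) := by
  have hk0 : (0 : ℝ) ≤ k := k.cast_nonneg
  have hkN : (k : ℝ) + 1 < N := by exact_mod_cast hk
  have h1 : poch (2 * a + α + N + 1) k ≠ 0 := (poch_pos (by linarith) k).ne'
  have h2 : poch (β + 1) k ≠ 0 := (poch_pos (by linarith) k).ne'
  have h3 : poch (1 - (N : ℝ)) k ≠ 0 := poch_ne_zero_of_add_lt_one (by linarith)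
  have h4 : (2 * a + α + N + 1 + k) ≠ 0 := by linarith
  have h5 : β + 1 + k ≠ 0 := by linarith
  have h6 : (1 : ℝ) - N + k ≠ 0 := by linarith
  have h7 : (k.factorial : ℝ) ≠ 0 := by positivity
  unfold racahCoeff
  rw [poch_succ, poch_succ, poch_succ, poch_succ, poch_succ, Nat.factorial_succ]
  push_cast
  field_simp
  ring

open Polynomial in
theorem degree_racahBasis (k : ℕ) : (racahBasis a k).degree = k := by
  unfold racahBasis
  rw [degree_prod, Finset.sum_congr rfl (g := fun _ => (1 : WithBot ℕ))]
  · simp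
  · intro j _
    rw [← neg_sub, degree_neg, degree_X_sub_C]

open Polynomial in
theorem degree_racah {n : ℕ} (hn : 1 ≤ n) (hnN : n < N) (ha : -1 / 2 < a) (hα : -1 < α)
    (hβ : -1 < β) : (racah a N n α β).degree = n := by
  have hn1 : (1 : ℝ) ≤ n := by exact_mod_cast hn
  have hnN1 : (n : ℝ) + 1 ≤ N := by exact_mod_cast hnN
  have hc : racahCoeff a N n α β n ≠ 0 := by
    unfold racahCoeff
    refine div_ne_zero (mul_ne_zero (poch_ne_zero_of_add_lt_one (by linarith))
      (poch_pos (by linarith) _).ne') (mul_ne_zero (mul_ne_zero (mul_ne_zero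
      (poch_pos (by linarith) _).ne' (poch_pos (by linarith) _).ne')
      (poch_ne_zero_of_add_lt_one (by linarith))) (by positivity))
  rw [racah_eq_sum, Finset.sum_range_succ, degree_add_eq_right_of_degree_lt]
  · rw [degree_C_mul hc, degree_racahBasis]
  · rw [degree_C_mul hc, degree_racahBasis]
    refine (degree_sum_le _ _).trans_lt ((Finset.sup_lt_iff (WithBot.bot_lt_coe _)).mpr ?_)
    intro k hk
    refine (degree_mul_le _ _).trans_lt
      (lt_of_le_of_lt (add_le_add_left degree_C_le _) ?_)
    rw [zero_add, degree_racahBasis]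
    exact_mod_cast Finset.mem_range.mp hk

theorem racahOperator_sum {ι : Type*} (s : Finset ι) (c : ι → ℝ) (f : ι → ℕ → ℝ) (j : ℕ) :
    racahOperator a N α β (fun i => ∑ k ∈ s, c k * f k i) j =
      ∑ k ∈ s, c k * racahOperator a N α β (f k) j := by
  simp only [racahOperator, mul_sub, mul_add, Finset.mul_sum, Finset.sum_add_distrib,
    Finset.sum_sub_distrib, mul_left_comm]

/-- The Racah polynomials are eigenfunctions of the Racah difference operator. -/
theorem racahOperator_racah {n : ℕ} (hnN : n < N) (ha : -1 / 2 < a) (hα : -1 < α) (hβ : -1 < β)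
    (j : ℕ) : racahOperator a N α β (fun i => (racah a N n α β).eval (racahGrid a i)) j =
      -n * (n + α + β + 1) * (racah a N n α β).eval (racahGrid a j) := by
  simp only [racah_eq_sum, Polynomial.eval_finsetSum, Polynomial.eval_mul, Polynomial.eval_C]
  rw [racahOperator_sum, Finset.sum_range_succ']
  simp only [racahOperator_basis_zero, racahOperator_basis_succ ha, mul_zero, add_zero]
  set c : ℕ → ℝ := racahCoeff a N n α β with hc
  set e : ℕ → ℝ := fun k => (racahBasis a k).eval (racahGrid a j)
  have hterm : ∀ k ∈ Finset.range n, c (k + 1) * (-(k + 1) * (k + α + β + 2) * e (k + 1) -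
      (k + 1) * (2 * a + α + N + 1 + k) * (β + 1 + k) * (N - 1 - k) * e k) =
      c (k + 1) * (-((k + 1 : ℕ) : ℝ) * ((k + 1 : ℕ) + α + β + 1) * e (k + 1)) -
        c k * ((n - k) * (n + k + α + β + 1)) * e k := by
    intro k hk
    have hk := Finset.mem_range.mp hk
    rw [hc, ← racahCoeff_succ ha hα hβ n (by omega)]
    push_cast
    ring
  -- Both sums extend to `k = 0, …, n`, since the added terms carry the factors `k` and `n - k`.
  -- They combine by `k (k + s) + (n - k)(n + k + s) = n (n + s)` with `s = α + β + 1`.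
  have hshift := Finset.sum_range_succ' (fun k : ℕ => c k *
    (-(k : ℝ) * (k + α + β + 1) * e k)) n
  have hsplit := Finset.sum_range_succ (fun k : ℕ => c k *
    ((n - k) * (n + k + α + β + 1)) * e k) n
  simp only [Nat.cast_zero, neg_zero, zero_mul, mul_zero, add_zero] at hshift
  simp only [sub_self, zero_mul, mul_zero, add_zero] at hsplit
  rw [Finset.sum_congr rfl hterm, Finset.sum_sub_distrib, ← hshift, ← hsplit,
    ← Finset.sum_sub_distrib, Finset.mul_sum]
  exact Finset.sum_congr rfl fun k _ => by ring

/-! ### Orthogonality of the Racah polynomials -/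

/-- Polynomials of degree less than `n` are spanned by `racahBasis a k`, `k < n`. -/
theorem racahBasis_induction {n : ℕ} {p : Polynomial ℝ → Prop}
    (hadd : ∀ f g, p f → p g → p (f + g)) (hmul : ∀ c f, p f → p (Polynomial.C c * f))
    (h0 : p 0) (hbasis : ∀ k < n, p (racahBasis a k)) (q : Polynomial ℝ) (hq : q.degree < n) :
    p q := by
  induction n generalizing q with
  | zero =>
    have : q = 0 := by simpa using hq
    rwa [this]
  | succ n ih =>
    have hb := degree_racahBasis (a := a) n
    have hlead : (racahBasis a n).coeff n ≠ 0 := Polynomial.coeff_ne_zero_of_eq_degree hb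
    set c := q.coeff n / (racahBasis a n).coeff n with hc
    have hdeg : (q - Polynomial.C c * racahBasis a n).degree < n := by
      rw [Polynomial.degree_lt_iff_coeff_zero]
      intro m hm
      rcases hm.eq_or_lt with rfl | hlt
      · simp only [Polynomial.coeff_sub, Polynomial.coeff_C_mul, hc]
        field_simp
        ring
      · have h1 : q.coeff m = 0 := (Polynomial.degree_lt_iff_coeff_zero _ _).mp hq m hlt
        have h2 : (racahBasis a n).coeff m = 0 :=
          Polynomial.coeff_eq_zero_of_degree_lt (by rw [hb]; exact_mod_cast hlt)
        simp [h1, h2]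
    have h := hadd _ _ (ih (fun k hk => hbasis k (by omega)) _ hdeg)
      (hmul c _ (hbasis n (by omega)))
    rwa [sub_add_cancel] at h

/-- The Racah polynomial of degree `n` is orthogonal to all polynomials of smaller degree. -/
theorem gridOrthogonal_racah {n : ℕ} (hnN : n < N) (ha : -1 / 2 < a) (hα : -1 < α)
    (hβ : β ∈ Set.Ioo (-1) (2 * a + 1)) :
    GridOrthogonal N n (racahGrid a) (racahWeight a N α β) (racah a N n α β) := by
  have hbasis : ∀ k < n, ∑ j ∈ Finset.range N, racahWeight a N α β j *
      ((racah a N n α β).eval (racahGrid a j) * (racahBasis a k).eval (racahGrid a j)) = 0 := by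
    intro k
    induction k with
    | zero =>
      intro hn
      have hn1 : (1 : ℝ) ≤ n := by exact_mod_cast hn
      have h := sum_racahWeight_operator_comm (N := N) ha hα hβ.2
        (fun i => (racah a N n α β).eval (racahGrid a i))
        (fun i => (racahBasis a 0).eval (racahGrid a i))
      simp only [racahOperator_racah hnN ha hα hβ.1, racahOperator_basis_zero, mul_zero,
        Finset.sum_const_zero] at h
      have hne : -(n : ℝ) * (n + α + β + 1) ≠ 0 :=
        mul_ne_zero (by linarith) (by linarith [hβ.1])
      refine (mul_eq_zero.mp (Eq.trans ?_ h)).resolve_left hne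
      rw [Finset.mul_sum]
      exact Finset.sum_congr rfl fun j _ => by ring
    | succ k ih =>
      intro hk
      have hk0 : (0 : ℝ) ≤ k := k.cast_nonneg
      have hkn : (k : ℝ) + 1 < n := by exact_mod_cast hk
      have h := sum_racahWeight_operator_comm (N := N) ha hα hβ.2
        (fun i => (racah a N n α β).eval (racahGrid a i))
        (fun i => (racahBasis a (k + 1)).eval (racahGrid a i))
      simp only [racahOperator_racah hnN ha hα hβ.1, racahOperator_basis_succ ha] at h
      -- This is the difference of the eigenvalues of degrees `n` and `k + 1`. Symmetry equates its
      -- product with the moment of order `k + 1` to a multiple of the moment of order `k`, which is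
      -- zero by induction.
      have hne : ((k : ℝ) + 1 - n) * (n + k + α + β + 2) ≠ 0 :=
        mul_ne_zero (by linarith) (by linarith [hβ.1])
      refine (mul_eq_zero.mp ?_).resolve_left hne
      have h' := sub_eq_zero.mpr h
      have ih' := ih (by omega)
      have hcomb : ((k : ℝ) + 1 - n) * (n + k + α + β + 2) *
          ∑ j ∈ Finset.range N, racahWeight a N α β j *
            ((racah a N n α β).eval (racahGrid a j) *
              (racahBasis a (k + 1)).eval (racahGrid a j)) +
          ((k + 1) * (2 * a + α + N + 1 + k) * (β + 1 + k) * (N - 1 - k)) *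
          ∑ j ∈ Finset.range N, racahWeight a N α β j *
            ((racah a N n α β).eval (racahGrid a j) *
              (racahBasis a k).eval (racahGrid a j)) = 0 := by
        rw [← h', Finset.mul_sum, Finset.mul_sum, ← Finset.sum_add_distrib,
          ← Finset.sum_sub_distrib]
        exact Finset.sum_congr rfl fun j _ => by ring
      rwa [ih', mul_zero, add_zero] at hcomb
  intro q hq
  refine racahBasis_induction (a := a) (n := n) (p := fun q => ∑ j ∈ Finset.range N,
    racahWeight a N α β j * (racah a N n α β * q).eval (racahGrid a j) = 0) ?_ ?_ ?_ ?_ q hq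
  · intro f g hf hg
    simp only [mul_add, Polynomial.eval_add, Finset.sum_add_distrib, hf, hg, add_zero]
  · intro c f hf
    rw [← mul_zero c, ← hf, Finset.mul_sum]
    refine Finset.sum_congr rfl fun j _ => ?_
    simp only [Polynomial.eval_mul, Polynomial.eval_C]
    ring
  · simp
  · intro k hk
    simpa only [Polynomial.eval_mul] using hbasis k hk

/-! ### Dependence of the weight and the zeros on the parameters -/

theorem div_lt_div_of_consecutive {w v : ℕ → ℝ}
    (h : ∀ k, k + 1 < N → v k / w k < v (k + 1) / w (k + 1)) (j k : ℕ) (hjk : j < k)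
    (hk : k < N) : v j / w j < v k / w k := by
  induction k, hjk using Nat.le_induction with
  | base => exact h j hk
  | succ k hjk ih => exact (ih (by omega)).trans (h k hk)

theorem racahWeight_succ (k : ℕ) : racahWeight a N α β (k + 1) =
    racahWeight a N α β k * (racahForward a N α β k / racahBackward a N α β (k + 1)) :=
  Finset.prod_range_succ _ _

/-- If the ratio of consecutive weights increases with the parameters, so do the zeros. -/
theorem racah_zeros_lt {n : ℕ} (hnN : n < N) (ha : -1 / 2 < a) {α' β' : ℝ} (hα : -1 < α)
    (hα' : -1 < α') (hβ : β ∈ Set.Ioo (-1) (2 * a + 1)) (hβ' : β' ∈ Set.Ioo (-1) (2 * a + 1))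
    (hstep : ∀ k, k + 1 < N → racahForward a N α β k / racahBackward a N α β (k + 1) <
      racahForward a N α' β' k / racahBackward a N α' β' (k + 1))
    {y z : Fin n → ℝ} (hy : EnumeratesZeros (racah a N n α β) y)
    (hz : EnumeratesZeros (racah a N n α' β') z) (i : Fin n)
    (hyi : y i < racahGrid a (N - 1)) : y i < z i := by
  refine (gridOrthogonal_racah hnN ha hα hβ).zeros_lt hnN (racahGrid_strictMono ha)
    (fun k hk => racahWeight_pos ha hα hβ hk) (fun k hk => racahWeight_pos ha hα' hβ' hk)
    (div_lt_div_of_consecutive fun k hk => ?_) hy hz (gridOrthogonal_racah hnN ha hα' hβ') i hyi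
  rw [racahWeight_succ, racahWeight_succ, mul_div_mul_comm]
  exact lt_mul_of_one_lt_right (div_pos (racahWeight_pos ha hα' hβ' (by omega))
    (racahWeight_pos ha hα hβ (by omega))) ((one_lt_div (div_pos (racahForward_pos ha hα hβ.1 hk)
      (racahBackward_succ_pos ha hα hβ.2 hk))).mpr (hstep k hk))

/-- Only `(α + N + k + 2a + 1) / (α + N - k - 1)` depends on `α`. It decreases because the numerator
exceeds the denominator by the positive constant `2k + 2a + 2`. -/
theorem racahForward_div_backward_strictAnti_left (ha : -1 / 2 < a) {α' : ℝ} (hα : -1 < α)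
    (hαα' : α < α') (hβ : β ∈ Set.Ioo (-1) (2 * a + 1)) {k : ℕ} (hk : k + 1 < N) :
    racahForward a N α' β k / racahBackward a N α' β (k + 1) <
      racahForward a N α β k / racahBackward a N α β (k + 1) := by
  have hf := racahForward_pos (N := N) ha hα hβ.1 hk
  have hb := racahBackward_succ_pos (N := N) ha hα hβ.2 hk
  have hb' := racahBackward_succ_pos (N := N) ha (hα.trans hαα') hβ.2 hk
  rw [div_lt_div_iff₀ hb' hb]
  have hk0 : (0 : ℝ) ≤ k := k.cast_nonneg
  have hkN : (k : ℝ) + 1 + 1 ≤ N := by exact_mod_cast hk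
  have h1 : 0 < k + 2 * a + α + N + 1 := by linarith
  have h2 : 0 < N + α - (k + 1) := by linarith
  have hf' : racahForward a N α' β k * (k + 2 * a + α + N + 1) =
      racahForward a N α β k * (k + 2 * a + α' + N + 1) := by
    unfold racahForward
    ring
  have hbb' : racahBackward a N α' β (k + 1) * (N + α - (k + 1)) =
      racahBackward a N α β (k + 1) * (N + α' - (k + 1)) := by
    unfold racahBackward
    push_cast
    ring
  have hpos : 0 < racahForward a N α β k * racahBackward a N α β (k + 1) *
      ((2 * k + 2 * a + 2) * (α' - α)) :=
    mul_pos (mul_pos hf hb) (mul_pos (by linarith) (by linarith))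
  refine lt_of_mul_lt_mul_right ?_ (mul_pos h1 h2).le
  linear_combination hpos + racahBackward a N α β (k + 1) * (N + α - (k + 1)) * hf' -
    racahForward a N α β k * (k + 2 * a + α + N + 1) * hbb'

/-- The numerator contains `β` through `k + β + 1`, the denominator through `k + 1 + 2a - β`, so one
increases and the other decreases. -/
theorem racahForward_div_backward_strictMono_right (ha : -1 / 2 < a) {β' : ℝ} (hα : -1 < α)
    (hββ' : β < β') (hβ : -1 < β) (hβ' : β' < 2 * a + 1) {k : ℕ} (hk : k + 1 < N) :
    racahForward a N α β k / racahBackward a N α β (k + 1) <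
      racahForward a N α β' k / racahBackward a N α β' (k + 1) := by
  have hk0 : (0 : ℝ) ≤ k := k.cast_nonneg
  have hb := racahBackward_succ_pos (N := N) ha hα (hββ'.trans hβ') hk
  have hb' := racahBackward_succ_pos (N := N) ha hα hβ' hk
  have hflt : racahForward a N α β k < racahForward a N α β' k := by
    have hf := racahForward_pos (N := N) ha hα hβ hk
    have h1 : 0 < k + β + 1 := by linarith
    have h : racahForward a N α β' k * (k + β + 1) =
        racahForward a N α β k * (k + β' + 1) := by
      unfold racahForward
      ring
    refine lt_of_mul_lt_mul_right ?_ h1.le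
    rw [h]
    exact mul_lt_mul_of_pos_left (by linarith) hf
  have hblt : racahBackward a N α β' (k + 1) < racahBackward a N α β (k + 1) := by
    have h1 : 0 < k + 1 + 2 * a - β := by linarith
    have h : racahBackward a N α β' (k + 1) * (k + 1 + 2 * a - β) =
        racahBackward a N α β (k + 1) * (k + 1 + 2 * a - β') := by
      unfold racahBackward
      push_cast
      ring
    refine lt_of_mul_lt_mul_right ?_ h1.le
    rw [h]
    exact mul_lt_mul_of_pos_left (by linarith) hb
  exact div_lt_div₀ hflt hblt.le (racahForward_pos ha hα (hβ.trans hββ') hk).le hb'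

theorem racahZerosMonotone_of_subset {n : ℕ} (hn : 1 ≤ n) (hnN : n < N) (ha : -1 / 2 < a)
    {J : Set ℝ} (hJ : J ⊆ Set.Ioo (-1) (2 * a + 1)) : RacahZerosMonotone a N n J := by
  have hex : ∀ α β : ℝ, ∃ y : Fin n → ℝ, -1 < α → β ∈ J →
      EnumeratesZeros (racah a N n α β) y ∧
        ∀ i, y i ∈ Set.Ioo (racahGrid a 0) (racahGrid a (N - 1)) := by
    intro α β
    by_cases h : -1 < α ∧ β ∈ J
    · obtain ⟨y, hy⟩ := (gridOrthogonal_racah hnN ha h.1 (hJ h.2)).exists_enumeratesZeros hnN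
        (racahGrid_strictMono ha) (fun k hk => racahWeight_pos ha h.1 (hJ h.2) hk)
        (degree_racah hn hnN ha h.1 (hJ h.2).1)
      exact ⟨y, fun _ _ => hy⟩
    -- A default value outside the parameter range, so that `Y` is defined for all real parameters.
    · exact ⟨0, fun h1 h2 => absurd ⟨h1, h2⟩ h⟩
  choose Y hY using hex
  have hlast : racahGrid a (N - 1) = (a + N - 1) * (a + N) := by
    have : ((N - 1 : ℕ) : ℝ) = N - 1 := by
      rw [Nat.cast_sub (by omega)]
      simp
    rw [racahGrid, this]
    ring
  have hfirst : racahGrid a 0 = a * (a + 1) := by simp [racahGrid]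
  refine ⟨fun i α β => Y α β i, fun α hα β hβ => ?_, fun β hβ i α hα α' hα' h => ?_,
    fun α hα i β hβ β' hβ' h => ?_⟩
  · rw [← hfirst, ← hlast]
    exact hY α β hα hβ
  -- The weight quotient is larger for the smaller `α`, so `α'` plays the role of the first weight.
  · exact racah_zeros_lt hnN ha hα' hα (hJ hβ) (hJ hβ)
      (fun k hk => racahForward_div_backward_strictAnti_left ha hα h (hJ hβ) hk)
      (hY α' β hα' hβ).1 (hY α β hα hβ).1 i ((hY α' β hα' hβ).2 i).2
  · exact racah_zeros_lt hnN ha hα hα (hJ hβ) (hJ hβ')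
      (fun k hk => racahForward_div_backward_strictMono_right ha hα h (hJ hβ).1 (hJ hβ').2 hk)
      (hY α β hα hβ).1 (hY α β' hα hβ').1 i ((hY α β hα hβ).2 i).2

end

theorem mainTheorem4 (a : ℝ) (N n : ℕ) (hn : 1 ≤ n) (hnN : n < N) :
    (0 ≤ a → RacahZerosMonotone a N n (Set.Ioo (-1) (2 * a + 1))) ∧
    (-1 / 2 < a → a < 0 → RacahZerosMonotone a N n (Set.Ioo a (2 * a + 1))) :=
  ⟨fun ha => racahZerosMonotone_of_subset hn hnN (by linarith) subset_rfl,
    fun ha _ => racahZerosMonotone_of_subset hn hnN ha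
      (Set.Ioo_subset_Ioo_left (by linarith))⟩
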